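/- Let $M$ be a $d \times n$ integer matrix of full row rank $d$ that is unimodular, i.e. all of its maximal ($d \times d$) minors lie in $\{-1,0,1\}$, and let $L = M M^{\top}$, a real symmetric $d \times d$ matrix with eigenvalues $\lambda_1,\dots,\lambda_d$ (listed with multiplicity). For a real matrix $A$ with $d$ rows and columns $A_1,\dots,A_m$, let $Z(A) = \sum_{j=1}^m \operatorname{conv}\{0, A_j\} \subset \mathbb{R}^d$ (Minkowski sum) be the zonotope generated by $A$, and let $\operatorname{vol}$ be $d$-dimensional Lebesgue measure. Then $\det L > 0$ and $$\operatorname{vol} Z(M) = \operatorname{vol} Z(L) = \det L = \lambda_1 \cdots \lambda_d .$$ Moreover $\operatorname{vol} Z(M)$ equals the number of bases of the matroid $\mathcal{M}(M)$ on $\{1,\dots,n\}$ whose independent sets are the sets of indices of linearly independent columns of $M$ over $\mathbb{R}$; hence the number of bases of $\mathcal{M}(M)$ is $\lambda_1\cdots\lambda_d$. -/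

import Mathlib

open MeasureTheory
open scoped Pointwise

/-- The matrix with real entries underlying an integer matrix. -/
def toReal {d n : ℕ} (M : Matrix (Fin d) (Fin n) ℤ) : Matrix (Fin d) (Fin n) ℝ :=
  M.map (Int.cast : ℤ → ℝ)

/-- An integer matrix `M` of rank `r` is unimodular if all of its maximal minors (the determinants
of its `r × r` submatrices) are in `{-1, 0, 1}`. -/
def IsUnimodular {d n : ℕ} (M : Matrix (Fin d) (Fin n) ℤ) : Prop :=
  ∀ (f : Fin (toReal M).rank → Fin d) (g : Fin (toReal M).rank → Fin n),
    f.Injective → g.Injective → (M.submatrix f g).det ∈ ({-1, 0, 1} : Set ℤ)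

/-- The matrix `L = M Mᵀ`. -/
def laplacian {d n : ℕ} (M : Matrix (Fin d) (Fin n) ℤ) : Matrix (Fin d) (Fin d) ℤ :=
  M * M.transpose

/-- `L` is a real symmetric matrix, so that its `d` real eigenvalues, listed with multiplicity,
are `(laplacian_isHermitian M).eigenvalues : Fin d → ℝ`. -/
theorem laplacian_isHermitian {d n : ℕ} (M : Matrix (Fin d) (Fin n) ℤ) :
    (toReal (laplacian M)).IsHermitian := by
  ext i j
  simp [toReal, laplacian, Matrix.mul_apply, mul_comm]

/-- The zonotope generated by a real matrix: the Minkowski sum in `ℝ^d` of the line segments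
from the origin to its columns. -/
def zonotope {d n : ℕ} (A : Matrix (Fin d) (Fin n) ℝ) : Set (Fin d → ℝ) :=
  ∑ j : Fin n, segment ℝ 0 (A.col j)

/-- The matroid of a real matrix: the ground set is the set of indices of the columns, and a set
of indices is independent if the corresponding family of columns is linearly independent. -/
def columnMatroid {d n : ℕ} (A : Matrix (Fin d) (Fin n) ℝ) : Matroid (Fin n) :=
  (IndepMatroid.ofFinite (E := Set.univ) Set.finite_univ
    (Indep := fun I => LinearIndepOn ℝ A.col I)
    (indep_empty := linearIndepOn_empty ℝ A.col)
    (indep_subset := fun _ _ hJ hIJ => hJ.mono hIJ)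
    (indep_aug := by
      intro I J hI hJ hIJ
      by_contra! hcon
      have hspan : Submodule.span ℝ (A.col '' J) ≤ Submodule.span ℝ (A.col '' I) := by
        rw [Submodule.span_le]
        rintro _ ⟨e, he, rfl⟩
        by_cases heI : e ∈ I
        · exact Submodule.subset_span ⟨e, heI, rfl⟩
        · by_contra hnot
          exact hcon e he heI (hI.insert hnot)
      have hcard : ∀ K : Set (Fin n), LinearIndepOn ℝ A.col K →
          Module.finrank ℝ (Submodule.span ℝ (A.col '' K)) = K.ncard := by
        intro K hK
        classical
        have h := finrank_span_eq_card (R := ℝ) (b := fun k : K => A.col k) hK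
        rw [Set.image_eq_range, h, ← Nat.card_eq_fintype_card, Nat.card_coe_set_eq]
      have hle := Submodule.finrank_mono hspan
      rw [hcard J hJ, hcard I hI] at hle
      omega)
    (subset_ground := fun _ _ => Set.subset_univ _)).matroid

/-- The bases of the matroid of `A` are the maximal linearly independent sets of columns. -/
theorem columnMatroid_isBase_iff {d n : ℕ} (A : Matrix (Fin d) (Fin n) ℝ) (B : Set (Fin n)) :
    (columnMatroid A).IsBase B ↔ Maximal (fun I => LinearIndepOn ℝ A.col I) B :=
  Iff.rfl

/-!
The volume of the zonotope of a real `d × n` matrix `A` is the sum of the absolute values of the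
`d × d` minors of `A` (`volume_zonotope`). By the Cauchy–Binet formula
(`det_mul_eq_sum_orderEmbedding`), `det (A Aᵀ)` is the sum of the squares of the same minors. When
`A` is unimodular of rank `d`, these minors are in `{-1, 0, 1}`, so both sums count the nonzero
minors. A minor is nonzero exactly when its columns are linearly independent, so the nonzero minors
correspond to the bases of the column matroid (`ncard_isBase`). The zonotope of the square matrix
`L = M Mᵀ` has a single minor, `det L`, which is positive because a matroid has at least one base,
and is the product of the eigenvalues of `L`.

The `d`-element sets of columns are encoded as increasing sequences `Fin d ↪o Fin n`.
-/

/-! ### Zonotopes -/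

/-- A linear map sends a zonotope to the zonotope generated by the images of the generators. -/
theorem image_zonotope {d e n : ℕ} (f : (Fin d → ℝ) →ₗ[ℝ] (Fin e → ℝ))
    (A : Matrix (Fin d) (Fin n) ℝ) (B : Matrix (Fin e) (Fin n) ℝ)
    (h : ∀ j, f (A.col j) = B.col j) : f '' zonotope A = zonotope B := by
  simp only [zonotope, Set.image_finsetSum]
  refine Finset.sum_congr rfl fun j _ => ?_
  rw [← h j, ← map_zero f]
  exact image_segment ℝ f.toAffineMap 0 (A.col j)

theorem zonotope_succ {d n : ℕ} (A : Matrix (Fin d) (Fin (n + 1)) ℝ) :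
    zonotope A = segment ℝ 0 (A.col 0) + zonotope (A.submatrix id Fin.succ) := by
  simp only [zonotope, Fin.sum_univ_succ]
  rfl

theorem zonotope_compact_convex {d n : ℕ} (A : Matrix (Fin d) (Fin n) ℝ) :
    IsCompact (zonotope A) ∧ Convex ℝ (zonotope A) ∧ (zonotope A).Nonempty := by
  induction n with
  | zero => simp [zonotope, ← Set.singleton_zero, convex_singleton]
  | succ n ih =>
    obtain ⟨h1, h2, h3⟩ := ih (A.submatrix id Fin.succ)
    rw [zonotope_succ]
    refine ⟨IsCompact.add ?_ h1, (convex_segment _ _).add h2,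
      Set.Nonempty.add ⟨0, left_mem_segment ℝ _ _⟩ h3⟩
    rw [segment_eq_image]
    exact isCompact_Icc.image (by fun_prop)

theorem volume_zonotope_mul {d n : ℕ} (T : Matrix (Fin d) (Fin d) ℝ)
    (A : Matrix (Fin d) (Fin n) ℝ) :
    volume (zonotope (T * A)) = ENNReal.ofReal |T.det| * volume (zonotope A) := by
  have h : Matrix.toLin' T '' zonotope A = zonotope (T * A) := by
    refine image_zonotope _ _ _ fun j => ?_
    ext i
    simp [Matrix.mulVec, dotProduct, Matrix.mul_apply, Matrix.col]
  rw [← h, Measure.addHaar_image_linearMap, LinearMap.det_toLin']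

/-! ### Extending a convex body along a coordinate axis -/

open Classical in
/-- Adding a unit segment to a compact interval lengthens it by `1`, unless it is empty. -/
theorem volume_Icc_add {S : Set ℝ} (hc : IsCompact S) (hv : Convex ℝ S) :
    volume (Set.Icc (0 : ℝ) 1 + S) = volume S + if S.Nonempty then 1 else 0 := by
  rcases S.eq_empty_or_nonempty with rfl | hne
  · simp
  · have hS := eq_Icc_of_connected_compact ⟨hne, hv.isPreconnected⟩ hc
    have hle : sInf S ≤ sSup S := by
      rw [← Set.nonempty_Icc, ← hS]
      exact hne
    rw [if_pos hne, hS, Set.Icc_add_Icc zero_le_one hle, Real.volume_Icc, Real.volume_Icc,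
      ← ENNReal.ofReal_one, ← ENNReal.ofReal_add (by linarith) zero_le_one]
    congr 1
    ring

theorem volume_eq_lintegral_cons {d : ℕ} {K : Set (Fin (d + 1) → ℝ)} (hK : MeasurableSet K) :
    volume K = ∫⁻ y : Fin d → ℝ, volume {x : ℝ | (Fin.cons x y : Fin (d + 1) → ℝ) ∈ K} := by
  have hp := (volume_preserving_piFinSuccAbove (fun _ : Fin (d + 1) => ℝ) 0).symm
  rw [← hp.measure_preimage_equiv K, Measure.volume_eq_prod, Measure.prod_apply_symm
    ((MeasurableEquiv.measurable _) hK)]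
  refine lintegral_congr fun y => congrArg _ ?_
  ext x
  simp [MeasurableEquiv.piFinSuccAbove, Fin.insertNthEquiv]

/-- Adding a unit segment in the direction of the first axis to a compact convex set `K` increases
its volume by the volume of the projection of `K` along that axis: by Fubini, each nonempty fibre
of the projection, which is an interval, gets longer by `1`. -/
theorem volume_segment_single_add {d : ℕ} {K : Set (Fin (d + 1) → ℝ)} (hc : IsCompact K)
    (hv : Convex ℝ K) :
    volume (segment ℝ 0 (Pi.single 0 1) + K) =
      volume K + volume (LinearMap.funLeft ℝ ℝ (Fin.succ : Fin d → Fin (d + 1)) '' K) := by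
  have hseg : segment ℝ (0 : Fin (d + 1) → ℝ) (Pi.single 0 1) =
      (fun t : ℝ => Pi.single 0 t) '' Set.Icc 0 1 := by
    rw [segment_eq_image]
    refine Set.image_congr fun t _ => ?_
    ext i
    refine Fin.cases ?_ (fun i => ?_) i <;> simp
  have hsegc : IsCompact (segment ℝ (0 : Fin (d + 1) → ℝ) (Pi.single 0 1)) := by
    rw [segment_eq_image]
    exact isCompact_Icc.image (by fun_prop)
  have hproj : MeasurableSet (LinearMap.funLeft ℝ ℝ (Fin.succ : Fin d → Fin (d + 1)) '' K) :=
    (hc.image (LinearMap.continuous_of_finiteDimensional _)).measurableSet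
  rw [volume_eq_lintegral_cons (hsegc.add hc).measurableSet,
    volume_eq_lintegral_cons hc.measurableSet, ← lintegral_indicator_one hproj,
    ← lintegral_add_right _ (measurable_one.indicator hproj)]
  refine lintegral_congr fun y => ?_
  have hfc : IsCompact {x : ℝ | (Fin.cons x y : Fin (d + 1) → ℝ) ∈ K} := by
    refine (hc.image (continuous_apply 0)).of_isClosed_subset
      (hc.isClosed.preimage (f := fun x : ℝ => (Fin.cons x y : Fin (d + 1) → ℝ)) ?_) ?_
    · exact Continuous.finCons (A := fun _ => ℝ) continuous_id continuous_const
    · intro x hx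
      exact ⟨_, hx, rfl⟩
  have hfv : Convex ℝ {x : ℝ | (Fin.cons x y : Fin (d + 1) → ℝ) ∈ K} := by
    intro a ha b hb s t hs ht hst
    have := hv ha hb hs ht hst
    rw [Set.mem_ofPred_eq]
    convert this using 1
    ext i
    refine Fin.cases ?_ (fun i => ?_) i
    · simp
    · simp [← add_mul, hst]
  have hfib : {x : ℝ | (Fin.cons x y : Fin (d + 1) → ℝ) ∈ segment ℝ 0 (Pi.single 0 1) + K} =
      Set.Icc 0 1 + {x : ℝ | (Fin.cons x y : Fin (d + 1) → ℝ) ∈ K} := by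
    ext x
    simp only [hseg, Set.mem_add, Set.mem_image, Set.mem_ofPred_eq]
    constructor
    · rintro ⟨_, ⟨t, ht, rfl⟩, k, hk, h⟩
      refine ⟨t, ht, k 0, ?_, ?_⟩
      · convert hk using 1
        ext i
        refine Fin.cases rfl (fun i => ?_) i
        have := congrFun h i.succ
        simpa using this.symm
      · simpa using congrFun h 0
    · rintro ⟨t, ht, z, hz, rfl⟩
      refine ⟨_, ⟨t, ht, rfl⟩, _, hz, ?_⟩
      ext i
      refine Fin.cases ?_ (fun i => ?_) i <;> simp
  have hmem : {x : ℝ | (Fin.cons x y : Fin (d + 1) → ℝ) ∈ K}.Nonempty ↔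
      y ∈ LinearMap.funLeft ℝ ℝ (Fin.succ : Fin d → Fin (d + 1)) '' K := by
    constructor
    · rintro ⟨x, hx⟩
      exact ⟨_, hx, by ext i; simp [LinearMap.funLeft_apply]⟩
    · rintro ⟨k, hk, rfl⟩
      refine ⟨k 0, ?_⟩
      rw [Set.mem_ofPred_eq]
      convert hk using 1
      ext i
      refine Fin.cases rfl (fun i => rfl) i
  rw [hfib, volume_Icc_add hfc hfv]
  classical
  simp only [Set.indicator_apply, hmem, Pi.one_apply]

/-! ### Increasing sequences of indices -/

/-- An increasing sequence of length `d + 1` in `Fin (n + 1)` either avoids `0`, or starts with `0`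
and goes on with an increasing sequence of length `d` of nonzero elements. -/
theorem sum_orderEmbedding_succ {α : Type*} [AddCommMonoid α] {d n : ℕ}
    (F : (Fin (d + 1) → Fin (n + 1)) → α) :
    ∑ g : Fin (d + 1) ↪o Fin (n + 1), F g =
      ∑ g : Fin (d + 1) ↪o Fin n, F (fun i => (g i).succ) +
      ∑ g : Fin d ↪o Fin n, F (Fin.cons 0 fun i => (g i).succ) := by
  let φ : (Fin (d + 1) ↪o Fin n) ⊕ (Fin d ↪o Fin n) → (Fin (d + 1) ↪o Fin (n + 1)) :=
    Sum.elim (fun g => g.trans (Fin.succOrderEmb n)) fun g =>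
      OrderEmbedding.ofStrictMono (Fin.cons 0 fun i => (g i).succ : Fin (d + 1) → Fin (n + 1)) (by
        exact Fin.strictMono_cons.2 ⟨fun _ => Fin.succ_pos _,
          (Fin.succOrderEmb n).strictMono.comp g.strictMono⟩)
  have hφ : φ.Bijective := by
    constructor
    · rintro (g | g) (h | h) hgh <;> have key := fun i => DFunLike.congr_fun hgh i
      · refine congrArg Sum.inl (DFunLike.ext _ _ fun i => ?_)
        simpa [φ] using key i
      · exact absurd (key 0) (by simp [φ])
      · exact absurd (key 0) (by simpa [φ] using (Fin.succ_ne_zero _).symm)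
      · refine congrArg Sum.inr (DFunLike.ext _ _ fun i => ?_)
        simpa [φ] using key i.succ
    · intro g
      by_cases h0 : g 0 = 0
      · have hpos : ∀ i : Fin d, g i.succ ≠ 0 := fun i =>
          ((Fin.zero_le _).trans_lt (g.strictMono i.succ_pos)).ne'
        refine ⟨Sum.inr (OrderEmbedding.ofStrictMono (fun i => (g i.succ).pred (hpos i))
          fun i j hij => ?_), DFunLike.ext _ _ fun i => ?_⟩
        · simpa using hij
        · refine Fin.cases ?_ (fun i => ?_) i
          · simp [φ, h0]
          · exact Fin.succ_pred _ (hpos i)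
      · have hpos : ∀ i, g i ≠ 0 := fun i =>
          ((Fin.pos_iff_ne_zero.2 h0).trans_le (g.monotone (Fin.zero_le i))).ne'
        refine ⟨Sum.inl (OrderEmbedding.ofStrictMono (fun i => (g i).pred (hpos i))
          fun i j hij => ?_), DFunLike.ext _ _ fun i => ?_⟩
        · simpa using hij
        · exact Fin.succ_pred _ (hpos i)
  rw [← Function.Bijective.sum_comp hφ (fun g => F g), Fintype.sum_sum_type]
  rfl

/-! ### The volume of a zonotope -/

/-- The volume of the zonotope of `A` is the sum of the absolute values of the maximal minors of
`A`. The induction removes the first column `v`. If `v ≠ 0`, a linear change of coordinates, which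
multiplies both sides by the same factor, turns it into the first basis vector. The volume is then
that of the zonotope of the other columns, plus that of its projection along `v`; these account for
the minors that avoid `v` and, after Laplace expansion, for those that contain it. -/
theorem volume_zonotope {d n : ℕ} (A : Matrix (Fin d) (Fin n) ℝ) :
    volume (zonotope A) = ∑ g : Fin d ↪o Fin n, ENNReal.ofReal |(A.submatrix id g).det| := by
  have hzero : ∀ {n : ℕ} (A : Matrix (Fin 0) (Fin n) ℝ), volume (zonotope A) =
      ∑ g : Fin 0 ↪o Fin n, ENNReal.ofReal |(A.submatrix id g).det| := by
    intro n A
    have h : zonotope A = Set.univ := by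
      obtain ⟨x, hx⟩ := (zonotope_compact_convex A).2.2
      exact Set.eq_univ_of_forall fun y => Subsingleton.elim x y ▸ hx
    have : Subsingleton (Fin 0 ↪o Fin n) := ⟨fun g g' => DFunLike.ext _ _ fun i => i.elim0⟩
    rw [Fintype.sum_subsingleton _ (OrderEmbedding.ofStrictMono Fin.elim0 fun i => i.elim0), h]
    simp [volume_pi]
  induction n generalizing d with
  | zero =>
    cases d with
    | zero => exact hzero A
    | succ d =>
      have : IsEmpty (Fin (d + 1) ↪o Fin 0) := ⟨fun g => (g 0).elim0⟩
      simp [zonotope, ← Set.singleton_zero]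
  | succ n ih =>
    cases d with
    | zero => exact hzero A
    | succ d =>
      have key : ∀ B : Matrix (Fin (d + 1)) (Fin (n + 1)) ℝ, B.col 0 = Pi.single 0 1 →
          volume (zonotope B) =
            ∑ g : Fin (d + 1) ↪o Fin (n + 1), ENNReal.ofReal |(B.submatrix id g).det| := by
        intro B hB
        have hcol : ∀ i, B i 0 = (Pi.single 0 1 : Fin (d + 1) → ℝ) i := congrFun hB
        obtain ⟨hc, hv, -⟩ := zonotope_compact_convex (B.submatrix id Fin.succ)
        rw [zonotope_succ, hB, volume_segment_single_add hc hv,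
          image_zonotope _ _ (B.submatrix Fin.succ Fin.succ) fun j => rfl, ih, ih,
          sum_orderEmbedding_succ fun f => ENNReal.ofReal |(B.submatrix id f).det|]
        congr 1
        refine Finset.sum_congr rfl fun g _ => ?_
        rw [Matrix.det_succ_column_zero (B.submatrix id _), Finset.sum_eq_single 0]
        · simp [hcol, Matrix.submatrix_submatrix]
          rfl
        · intro i _ hi
          simp [hcol, hi]
        · simp
      by_cases h0 : A.col 0 = 0
      · rw [zonotope_succ, h0, segment_same, Set.singleton_zero, zero_add, ih,
          sum_orderEmbedding_succ fun f => ENNReal.ofReal |(A.submatrix id f).det|]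
        refine ((congrArg _ (Finset.sum_eq_zero fun g _ => ?_)).trans (add_zero _)).symm
        have hdet : (A.submatrix id (Fin.cons 0 fun i => (g i).succ)).det = 0 :=
          Matrix.det_eq_zero_of_column_eq_zero 0 fun i => congrFun h0 i
        rw [hdet, abs_zero, ENNReal.ofReal_zero]
      · obtain ⟨f, hf⟩ := SeparatingDual.exists_continuousLinearEquiv_apply_eq (R := ℝ) h0
          (y := (Pi.single 0 1 : Fin (d + 1) → ℝ)) (by simp)
        set T := LinearMap.toMatrix' (f.toLinearEquiv : (Fin (d + 1) → ℝ) →ₗ[ℝ] (Fin (d + 1) → ℝ)) with hT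
        have hdet : T.det ≠ 0 := by
          rw [hT, LinearMap.det_toMatrix']
          exact f.toLinearEquiv.isUnit_det'.ne_zero
        have hTA : (T * A).col 0 = Pi.single 0 1 := by
          have h1 : T.mulVec (A.col 0) = Pi.single 0 1 := by
            rw [← hf, hT, LinearMap.toMatrix'_mulVec]
            rfl
          rw [← h1]
          rfl
        have h := key _ hTA
        rw [volume_zonotope_mul] at h
        have hsub : ∀ g : Fin (d + 1) ↪o Fin (n + 1),
            ENNReal.ofReal |((T * A).submatrix id g).det| =
              ENNReal.ofReal |T.det| * ENNReal.ofReal |(A.submatrix id g).det| := by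
          intro g
          have : (T * A).submatrix id g = T * A.submatrix id g := rfl
          rw [this, Matrix.det_mul, abs_mul, ENNReal.ofReal_mul (abs_nonneg _)]
        simp only [hsub, ← Finset.mul_sum] at h
        exact (ENNReal.mul_right_inj (by simpa using hdet) ENNReal.ofReal_ne_top).1 h

/-! ### The Cauchy–Binet formula -/

/-- The **Cauchy–Binet formula**, the maximal minors being indexed by increasing sequences. -/
theorem det_mul_eq_sum_orderEmbedding {R : Type*} [CommRing R] {d n : ℕ}
    (A : Matrix (Fin d) (Fin n) R) (B : Matrix (Fin n) (Fin d) R) :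
    (A * B).det =
      ∑ g : Fin d ↪o Fin n, (A.submatrix id g).det * (B.submatrix g id).det := by
  -- expand the determinant multilinearly in the rows of `A * B`
  have h1 : (A * B).det = ∑ f : Fin d → Fin n, (∏ i, A i (f i)) * (B.submatrix f id).det := by
    have hrow : (A * B) = fun i => ∑ j, A i j • B j := by
      ext i k
      simp [Matrix.mul_apply]
    have := (Matrix.detRowAlternating (n := Fin d) (R := R)).toMultilinearMap.map_sum
      fun i j => A i j • B j
    simp only [MultilinearMap.map_smul_univ] at this
    rw [hrow]
    exact this
  -- an injective `f` is uniquely an increasing sequence precomposed with a permutation, and the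
  -- other `f` contribute nothing, since they give a matrix with two equal rows
  let φ : (Fin d ↪o Fin n) × Equiv.Perm (Fin d) → (Fin d → Fin n) := fun p => p.1 ∘ p.2
  have hφ : φ.Injective := by
    rintro ⟨g, σ⟩ ⟨g', σ'⟩ h
    have hg : g = g' := by
      rw [← OrderEmbedding.range_inj, ← σ.surjective.range_comp g, ← σ'.surjective.range_comp g']
      exact congrArg Set.range h
    subst hg
    refine Prod.ext rfl (Equiv.ext fun i => ?_)
    exact g.injective (congrFun h i)
  rw [h1, ← Fintype.sum_of_injective φ hφ
    (fun p => (∏ i, A i (p.1 (p.2 i))) * (B.submatrix (p.1 ∘ p.2) id).det) _ ?_ fun _ => rfl,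
    Fintype.sum_prod_type]
  · refine Finset.sum_congr rfl fun g _ => ?_
    rw [← Matrix.det_transpose (A.submatrix id g), Matrix.det_apply', Finset.sum_mul]
    refine Finset.sum_congr rfl fun σ _ => ?_
    have : B.submatrix (g ∘ σ) id = (B.submatrix g id).submatrix σ id := rfl
    rw [this, Matrix.det_permute]
    simp only [Matrix.transpose_apply, Matrix.submatrix_apply, id]
    ring
  · intro f hf
    by_cases hinj : f.Injective
    · refine absurd ?_ hf
      have hcard : (Finset.univ.image f).card = d := by
        rw [Finset.card_image_of_injective _ hinj, Finset.card_fin]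
      have hmem : ∀ i, f i ∈ Set.range ((Finset.univ.image f).orderEmbOfFin hcard) := by
        intro i
        simp
      choose σ hσ using hmem
      have hσinj : σ.Injective := fun i j hij => hinj (by rw [← hσ i, ← hσ j, hij])
      exact ⟨(_, Equiv.ofBijective σ (Finite.injective_iff_bijective.1 hσinj)), funext hσ⟩
    · simp only [Function.Injective, not_forall] at hinj
      obtain ⟨i, j, hij, hne⟩ := hinj
      rw [Matrix.det_zero_of_row_eq hne, mul_zero]
      ext k
      simp [hij]

/-! ### Bases of the column matroid -/

theorem linearIndepOn_range_iff_det_ne_zero {d n : ℕ} (A : Matrix (Fin d) (Fin n) ℝ)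
    (g : Fin d ↪o Fin n) :
    LinearIndepOn ℝ A.col (Set.range g) ↔ (A.submatrix id g).det ≠ 0 := by
  rw [linearIndepOn_range_iff g.injective, ← isUnit_iff_ne_zero, ← Matrix.isUnit_iff_isUnit_det,
    ← Matrix.linearIndependent_cols_iff_isUnit]
  rfl

theorem ncard_eq_of_isBase {d n : ℕ} {A : Matrix (Fin d) (Fin n) ℝ} (hA : A.rank = d)
    {B : Set (Fin n)} (hB : (columnMatroid A).IsBase B) : B.ncard = d := by
  classical
  rw [columnMatroid_isBase_iff] at hB
  have hspan : Submodule.span ℝ (A.col '' B) = Submodule.span ℝ (Set.range A.col) := by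
    refine le_antisymm (Submodule.span_mono (Set.image_subset_range _ _)) ?_
    rw [Submodule.span_le]
    rintro _ ⟨e, rfl⟩
    by_contra hnot
    have heB := hB.2 (hB.1.insert hnot) (Set.subset_insert e B) (Set.mem_insert e B)
    exact hnot (Submodule.subset_span ⟨e, heB, rfl⟩)
  have h := finrank_span_eq_card (R := ℝ) (b := fun k : B => A.col k) hB.1
  rw [← Set.image_eq_range, hspan, ← Matrix.rank_eq_finrank_span_cols, hA,
    ← Nat.card_eq_fintype_card, Nat.card_coe_set_eq] at h
  exact h.symm

theorem isBase_iff {d n : ℕ} {A : Matrix (Fin d) (Fin n) ℝ} (hA : A.rank = d)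
    (B : Set (Fin n)) :
    (columnMatroid A).IsBase B ↔
      ∃ g : Fin d ↪o Fin n, (A.submatrix id g).det ≠ 0 ∧ Set.range g = B := by
  classical
  constructor
  · intro hB
    have hcard : B.toFinset.card = d := by
      rw [← Set.ncard_eq_toFinset_card', ncard_eq_of_isBase hA hB]
    have hrange : Set.range (B.toFinset.orderEmbOfFin hcard) = B := by simp
    refine ⟨B.toFinset.orderEmbOfFin hcard, ?_, hrange⟩
    rw [← linearIndepOn_range_iff_det_ne_zero, hrange]
    exact ((columnMatroid_isBase_iff A B).1 hB).1
  · rintro ⟨g, hg, rfl⟩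
    rw [← linearIndepOn_range_iff_det_ne_zero] at hg
    obtain ⟨B, hB, hsub⟩ :=
      Matroid.Indep.exists_isBase_superset (M := columnMatroid A) (I := Set.range g) hg
    rwa [Set.eq_of_subset_of_ncard_le hsub]
    rw [ncard_eq_of_isBase hA hB, ← Set.image_univ, Set.ncard_image_of_injective _ g.injective]
    simp

theorem ncard_isBase {d n : ℕ} {A : Matrix (Fin d) (Fin n) ℝ} (hA : A.rank = d) :
    {B | (columnMatroid A).IsBase B}.ncard =
      (Finset.univ.filter fun g : Fin d ↪o Fin n => (A.submatrix id g).det ≠ 0).card := by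
  have h : {B | (columnMatroid A).IsBase B} = (fun g : Fin d ↪o Fin n => Set.range g) ''
      (Finset.univ.filter fun g : Fin d ↪o Fin n => (A.submatrix id g).det ≠ 0) := by
    ext B
    simp [isBase_iff hA]
  rw [h, Set.ncard_image_of_injective _ fun g g' hg => OrderEmbedding.range_inj.1 hg,
    Set.ncard_coe_finset]

/-! ### Unimodular matrices -/

/-- A square matrix has only one maximal minor. -/
theorem volume_zonotope_square {d : ℕ} (A : Matrix (Fin d) (Fin d) ℝ) :
    volume (zonotope A) = ENNReal.ofReal |A.det| := by
  have : Subsingleton (Fin d ↪o Fin d) := ⟨fun g g' => OrderEmbedding.range_inj.1 <| by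
    rw [(Finite.surjective_of_injective g.injective).range_eq,
      (Finite.surjective_of_injective g'.injective).range_eq]⟩
  rw [volume_zonotope, Fintype.sum_subsingleton _ (RelEmbedding.refl _)]
  rfl

theorem IsUnimodular.det_eq {d n : ℕ} {M : Matrix (Fin d) (Fin n) ℤ}
    (hrank : (toReal M).rank = d) (hM : IsUnimodular M) (g : Fin d ↪o Fin n) :
    ((toReal M).submatrix id g).det = -1 ∨ ((toReal M).submatrix id g).det = 0 ∨
      ((toReal M).submatrix id g).det = 1 := by
  unfold IsUnimodular at hM
  rw [hrank] at hM
  have h := hM id g Function.injective_id g.injective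
  have hcast : ((toReal M).submatrix id g).det = ((M.submatrix id g).det : ℝ) := by
    rw [Int.cast_det]
    rfl
  rw [hcast]
  simp only [Set.mem_insert_iff, Set.mem_singleton_iff] at h
  exact_mod_cast h

theorem theorem3 {d n : ℕ} (M : Matrix (Fin d) (Fin n) ℤ)
    (hrank : (toReal M).rank = d) (hM : IsUnimodular M) :
    volume (zonotope (toReal M)) = volume (zonotope (toReal (laplacian M))) ∧
    0 < (toReal (laplacian M)).det ∧
    volume (zonotope (toReal (laplacian M))) = ENNReal.ofReal (toReal (laplacian M)).det ∧
    (toReal (laplacian M)).det = ∏ i : Fin d, (laplacian_isHermitian M).eigenvalues i ∧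
    volume (zonotope (toReal M)) = ({B | (columnMatroid (toReal M)).IsBase B}.ncard : ENNReal) ∧
    ({B | (columnMatroid (toReal M)).IsBase B}.ncard : ℝ) =
      ∏ i : Fin d, (laplacian_isHermitian M).eigenvalues i := by
  set N := {B | (columnMatroid (toReal M)).IsBase B}.ncard with hN
  have hL : toReal (laplacian M) = toReal M * (toReal M).transpose := by
    ext i j
    simp [toReal, laplacian, Matrix.mul_apply]
  have hvol : volume (zonotope (toReal M)) = (N : ENNReal) := by
    rw [volume_zonotope, hN, ncard_isBase hrank, Finset.card_filter, Nat.cast_sum]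
    refine Finset.sum_congr rfl fun g _ => ?_
    rcases hM.det_eq hrank g with h | h | h <;> simp [h]
  have hdet : (toReal (laplacian M)).det = (N : ℝ) := by
    rw [hL, det_mul_eq_sum_orderEmbedding, hN, ncard_isBase hrank, Finset.card_filter,
      Nat.cast_sum]
    refine Finset.sum_congr rfl fun g _ => ?_
    rw [← Matrix.transpose_submatrix, Matrix.det_transpose]
    rcases hM.det_eq hrank g with h | h | h <;> simp [h]
  have hpos : 0 < N := by
    obtain ⟨B, hB⟩ := (columnMatroid (toReal M)).exists_isBase
    exact (Set.ncard_pos (Set.toFinite _)).2 ⟨B, hB⟩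
  have heig : (toReal (laplacian M)).det = ∏ i, (laplacian_isHermitian M).eigenvalues i :=
    (laplacian_isHermitian M).det_eq_prod_eigenvalues
  have hvolL : volume (zonotope (toReal (laplacian M))) =
      ENNReal.ofReal (toReal (laplacian M)).det := by
    rw [volume_zonotope_square, hdet, abs_of_nonneg N.cast_nonneg]
  refine ⟨?_, ?_, hvolL, heig, hvol, hdet ▸ heig⟩
  · rw [hvol, hvolL, hdet, ENNReal.ofReal_natCast]
  · rw [hdet]
    exact_mod_cast hpos
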